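/- Let $d\ge 0$ be an integer, and let $G=\mathrm{SL}_d(\mathbb{R})$ carry the subspace topology from $\mathrm{M}_d(\mathbb{R})$. Then $\Gamma=\mathrm{SL}_d(\mathbb{Z})$ is a lattice in $G$. That is, $\Gamma$ is a discrete subgroup of $G$, there is a Borel fundamental set for $\Gamma$, i.e. a Borel set $F\subset G$ such that $G$ is the disjoint union of the sets $\gamma F$, $\gamma\in\Gamma$, and for every such $F$ and every left Haar measure $m$ on $G$, the induced Borel measure $$\mu(B)=m(\pi^{-1}(B)\cap F),\qquad B\subset \Gamma\backslash G \text{ Borel},$$ where $\pi:G\to\Gamma\backslash G$ is the factor map, satisfies $\mu(\Gamma\backslash G)<\infty$. -/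

import Mathlib

open MeasureTheory Matrix

open scoped ENNReal Pointwise

namespace HomogeneousLattice

section Quotient

variable {G : Type*} [Group G]

/-- The space `Γ \ G` of cosets `Γ g`. -/
def LeftQuotient (Γ : Subgroup G) : Type _ := Quotient (QuotientGroup.rightRel Γ)

/-- The factor map `π : G → Γ \ G`. -/
def proj (Γ : Subgroup G) (g : G) : LeftQuotient Γ :=
  Quotient.mk (QuotientGroup.rightRel Γ) g

theorem proj_eq_proj_iff (Γ : Subgroup G) (g h : G) :
    proj Γ g = proj Γ h ↔ ∃ γ ∈ Γ, h = γ * g := by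
  have key : proj Γ g = proj Γ h ↔ h * g⁻¹ ∈ Γ :=
    (Quotient.eq (r := QuotientGroup.rightRel Γ)).trans QuotientGroup.rightRel_apply
  rw [key]
  constructor
  · intro H
    exact ⟨h * g⁻¹, H, by group⟩
  · rintro ⟨γ, hγ, rfl⟩
    simpa using hγ

/-- `F` is a fundamental set for `Γ`: the group is the disjoint union of the sets `γ F`, `γ ∈ Γ`. -/
structure IsFundamentalSet (Γ : Subgroup G) (F : Set G) : Prop where
  iUnion_eq : ⋃ γ : Γ, (γ : G) • F = Set.univ
  disjoint : ∀ γ₁ γ₂ : Γ, γ₁ ≠ γ₂ → Disjoint ((γ₁ : G) • F) ((γ₂ : G) • F)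

variable [TopologicalSpace G]

/-- The quotient topology on `Γ \ G`. -/
instance instTopologicalSpaceLeftQuotient (Γ : Subgroup G) :
    TopologicalSpace (LeftQuotient Γ) :=
  TopologicalSpace.coinduced (proj Γ) inferInstance

/-- The Borel σ-algebra of `Γ \ G`. -/
instance instMeasurableSpaceLeftQuotient (Γ : Subgroup G) :
    MeasurableSpace (LeftQuotient Γ) :=
  borel (LeftQuotient Γ)

instance instBorelSpaceLeftQuotient (Γ : Subgroup G) : BorelSpace (LeftQuotient Γ) := ⟨rfl⟩

theorem continuous_proj (Γ : Subgroup G) : Continuous (proj Γ) := continuous_coinduced_rng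

variable [MeasurableSpace G] [BorelSpace G]

theorem measurable_proj (Γ : Subgroup G) : Measurable (proj Γ) := (continuous_proj Γ).measurable

/-- The measure on `Γ \ G` induced by a measure `m` on `G` and a fundamental set `F`;
see `quotientMeasure_apply`. -/
noncomputable def quotientMeasure (Γ : Subgroup G) (m : Measure G) (F : Set G) :
    Measure (LeftQuotient Γ) :=
  (m.restrict F).map (proj Γ)

theorem quotientMeasure_apply (Γ : Subgroup G) (m : Measure G) (F : Set G)
    {B : Set (LeftQuotient Γ)} (hB : MeasurableSet B) :
    quotientMeasure Γ m F B = m (proj Γ ⁻¹' B ∩ F) := by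
  rw [quotientMeasure, Measure.map_apply (measurable_proj Γ) hB,
    Measure.restrict_apply (measurable_proj Γ hB)]

/-- A subgroup `Γ` of `G` is a lattice if it is discrete and `Γ \ G` has finite total mass for the
measure induced by the left Haar measure of `G`.

The induced measure is built with a Borel fundamental set. It does not depend on that set; the
definition asks that such a set exists, and that the mass is finite for each choice of the Borel
fundamental set and each normalisation of the Haar measure. -/
structure IsLattice [IsTopologicalGroup G] [LocallyCompactSpace G] (Γ : Subgroup G) : Prop where
  discrete : DiscreteTopology Γ
  exists_fundamentalSet : ∃ F : Set G, MeasurableSet F ∧ IsFundamentalSet Γ F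
  finite_quotient : ∀ (m : Measure G) [m.IsHaarMeasure] (F : Set G),
    MeasurableSet F → IsFundamentalSet Γ F → quotientMeasure Γ m F Set.univ < ∞

end Quotient

section SpecialLinear

/-- `SL_d(ℝ)` carries the subspace topology from the real matrices, in which it is closed. -/
theorem isClosedEmbedding_coe (d : ℕ) :
    Topology.IsClosedEmbedding
      (fun g : SpecialLinearGroup (Fin d) ℝ => (g : Matrix (Fin d) (Fin d) ℝ)) := by
  refine ⟨⟨⟨rfl⟩, Subtype.coe_injective⟩, ?_⟩
  have : Set.range (fun g : SpecialLinearGroup (Fin d) ℝ => (g : Matrix (Fin d) (Fin d) ℝ))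
      = {A | A.det = 1} := Subtype.range_coe
  rw [this]
  exact isClosed_eq (continuous_id.matrix_det) continuous_const

instance instLocallyCompactSpaceSL (d : ℕ) :
    LocallyCompactSpace (SpecialLinearGroup (Fin d) ℝ) :=
  haveI : LocallyCompactSpace (Matrix (Fin d) (Fin d) ℝ) :=
    inferInstanceAs (LocallyCompactSpace (Fin d → Fin d → ℝ))
  (isClosedEmbedding_coe d).locallyCompactSpace

/-- The Borel σ-algebra of `SL_d(ℝ)`. -/
instance instMeasurableSpaceSL (d : ℕ) : MeasurableSpace (SpecialLinearGroup (Fin d) ℝ) :=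
  borel (SpecialLinearGroup (Fin d) ℝ)

instance instBorelSpaceSL (d : ℕ) : BorelSpace (SpecialLinearGroup (Fin d) ℝ) := ⟨rfl⟩

/-- `SL_d(ℤ)` as a subgroup of `SL_d(ℝ)`: the image of the entrywise inclusion. -/
def integerSL (d : ℕ) : Subgroup (SpecialLinearGroup (Fin d) ℝ) :=
  (SpecialLinearGroup.map (n := Fin d) (Int.castRingHom ℝ)).range

end SpecialLinear

end HomogeneousLattice

/-! Haar measure is realised through a cone: a Borel set of `SL_d(ℝ)` gets the Lebesgue measure of
the matrices with determinant in `(0, 1]` that project radially into it. Left multiplication by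
determinant-one matrices preserves Lebesgue measure, so this measure is left invariant, and for `d ≥
1` it is a nonzero multiple of any given Haar measure. It remains to bound the volume of the cone
`E` over `F`. The sets `γE` are disjoint; if a set `S` of finite volume meets every `SL_d(ℤ)`-orbit
in the truncated cone, then `E` is covered by pieces that move to disjoint subsets of `S`, so `vol E
≤ vol S` (`coneMeasure_lt_top`).

The set `S` comes from induction on `d` (`exists_isCovering_succ`). Minkowski's theorem and the
Euclidean algorithm make the first row bounded. Right multiplication by a determinant-one matrix
depending only on that row turns it into the first basis vector. The complementary block keeps the
determinant, so the induction hypothesis applies to it, and integral row operations bring the first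
column into `[0, 1]`. The change of coordinates preserves volume, so up to a null set `S` is the
preimage of a product of two boxes and the previous `S`. -/

namespace HomogeneousLattice

/-! ### Lebesgue measure on matrices -/

section Matrices

noncomputable instance instMeasureSpaceMatrix (m n : ℕ) : MeasureSpace (Matrix (Fin m) (Fin n) ℝ) :=
  inferInstanceAs (MeasureSpace (Fin m → Fin n → ℝ))

instance instBorelSpaceMatrix (m n : ℕ) : BorelSpace (Matrix (Fin m) (Fin n) ℝ) :=
  inferInstanceAs (BorelSpace (Fin m → Fin n → ℝ))

instance instSigmaFiniteMatrix (m n : ℕ) :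
    SigmaFinite (volume : Measure (Matrix (Fin m) (Fin n) ℝ)) :=
  inferInstanceAs (SigmaFinite (volume : Measure (Fin m → Fin n → ℝ)))

/-- Right multiplication by a matrix of determinant one preserves Lebesgue measure. -/
theorem measurePreserving_mul_right {m n : ℕ} {h : Matrix (Fin n) (Fin n) ℝ} (hh : h.det = 1) :
    MeasurePreserving (fun X : Matrix (Fin m) (Fin n) ℝ => X * h) := by
  -- Right multiplication acts on each row separately.
  have row : MeasurePreserving (fun x : Fin n → ℝ => x ᵥ* h) := by
    have hdet : hᵀ.det ≠ 0 := by rw [det_transpose, hh]; exact one_ne_zero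
    have hmap := Real.map_matrix_volume_pi_eq_smul_volume_pi hdet
    have hfun : (fun x : Fin n → ℝ => x ᵥ* h) = toLin' hᵀ := by
      ext x
      simp [toLin'_apply, mulVec_transpose]
    rw [hfun]
    refine ⟨(LinearMap.continuous_of_finiteDimensional _).measurable, ?_⟩
    rw [hmap, det_transpose, hh]
    simp
  exact volume_preserving_pi (ι := Fin m) (α' := fun _ => Fin n → ℝ) (β' := fun _ => Fin n → ℝ)
    (f := fun _ x => x ᵥ* h) (fun _ => row)

/-- Transposition preserves Lebesgue measure. -/
theorem measurePreserving_transpose (n : ℕ) :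
    MeasurePreserving (fun X : Matrix (Fin n) (Fin n) ℝ => Xᵀ) := by
  let T : (Fin n → Fin n → ℝ) →ₗ[ℝ] (Fin n → Fin n → ℝ) :=
    { toFun := fun X i j => X j i
      map_add' := fun _ _ => rfl
      map_smul' := fun _ _ => rfl }
  -- An involution has determinant `±1`.
  have hTT : T ∘ₗ T = LinearMap.id := rfl
  have hdet : LinearMap.det T * LinearMap.det T = 1 := by
    rw [← LinearMap.det_comp, hTT, LinearMap.det_id]
  have hne : LinearMap.det T ≠ 0 := fun h => by simp [h] at hdet
  have habs : |LinearMap.det T| = 1 := by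
    rcases mul_self_eq_one_iff.1 hdet with h | h <;> simp [h]
  have : MeasurePreserving T := by
    refine ⟨(LinearMap.continuous_of_finiteDimensional T).measurable, ?_⟩
    rw [Measure.map_linearMap_addHaar_eq_smul_addHaar _ hne, abs_inv, habs]
    simp
  exact this

/-- Left multiplication by a matrix of determinant one preserves Lebesgue measure. -/
theorem measurePreserving_mul_left {n : ℕ} {h : Matrix (Fin n) (Fin n) ℝ} (hh : h.det = 1) :
    MeasurePreserving (fun X : Matrix (Fin n) (Fin n) ℝ => h * X) := by
  have h1 : MeasurePreserving (fun X : Matrix (Fin n) (Fin n) ℝ => X * hᵀ) :=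
    measurePreserving_mul_right (by rw [det_transpose, hh])
  have h2 := (measurePreserving_transpose n).comp (h1.comp (measurePreserving_transpose n))
  have h3 : (fun X : Matrix (Fin n) (Fin n) ℝ => Xᵀ) ∘ (fun X => X * hᵀ) ∘ (fun X => Xᵀ)
      = fun X => h * X := by
    ext1 X
    simp [transpose_mul]
  rwa [h3] at h2

end Matrices

/-! ### Euclidean algorithm on integer vectors -/

section Integers

/-- Adding a multiple of one coordinate to another, as a product with a transvection. -/
theorem vecMul_transvection {n R : Type*} [Fintype n] [DecidableEq n] [CommRing R] (v : n → R)
    (i j : n) (t : R) : v ᵥ* transvection i j t = v + Pi.single j (v i * t) := by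
  ext l
  rw [transvection, vecMul_add, vecMul_one]
  by_cases hl : l = j
  · subst hl; simp [vecMul, dotProduct, single_apply]
  · simp [vecMul, dotProduct, hl, Ne.symm hl]

/-- The orbit of an integer vector under the special linear group contains a multiple of the first
basis vector. -/
theorem exists_vecMul_eq_single {d : ℕ} (c : Fin (d + 1) → ℤ) :
    ∃ (γ : Matrix (Fin (d + 1)) (Fin (d + 1)) ℤ) (k : ℤ),
      γ.det = 1 ∧ c ᵥ* γ = Pi.single 0 k := by
  -- While two entries are nonzero, adding or subtracting the smaller to or from the larger lowers
  -- the sum of absolute values.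
  induction hN : ∑ i, (c i).natAbs using Nat.strong_induction_on generalizing c with
  | _ N ih =>
    by_cases hc : ∃ i j, i ≠ j ∧ c i ≠ 0 ∧ c j ≠ 0
    · obtain ⟨i, j, hij, hi, hj, hle⟩ :
          ∃ i j, i ≠ j ∧ c i ≠ 0 ∧ c j ≠ 0 ∧ (c i).natAbs ≤ (c j).natAbs := by
        obtain ⟨i, j, hij, hi, hj⟩ := hc
        rcases le_total (c i).natAbs (c j).natAbs with h | h
        · exact ⟨i, j, hij, hi, hj, h⟩
        · exact ⟨j, i, hij.symm, hj, hi, h⟩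
      obtain ⟨t, ht⟩ : ∃ t : ℤ, (c j + c i * t).natAbs < (c j).natAbs := by
        by_cases hs : (0 < c i ↔ 0 < c j)
        · exact ⟨-1, by omega⟩
        · exact ⟨1, by omega⟩
      obtain ⟨γ, k, hdet, hγ⟩ := ih _ (by
        rw [← hN]
        refine Finset.sum_lt_sum (fun l _ => ?_) ⟨j, Finset.mem_univ j, ?_⟩
          (g := fun i => (c i).natAbs)
          (f := fun l => ((c + Pi.single j (c i * t) : Fin (d + 1) → ℤ) l).natAbs)
        · by_cases hl : l = j
          · subst hl
            simpa using ht.le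
          · simp [hl]
        · simpa using ht) (c + Pi.single j (c i * t)) rfl
      refine ⟨transvection i j t * γ, k, ?_, ?_⟩
      · rw [det_mul, det_transvection_of_ne _ _ hij, hdet, one_mul]
      · rw [← vecMul_vecMul, vecMul_transvection, hγ]
    · push Not at hc
      obtain ⟨i, hi⟩ : ∃ i, c = Pi.single i (c i) := by
        by_cases h0 : ∃ i, c i ≠ 0
        · obtain ⟨i, hi⟩ := h0
          refine ⟨i, funext fun l => ?_⟩
          by_cases hl : l = i
          · subst hl; simp
          · simp [hl, hc i l (Ne.symm hl) hi]
        · push Not at h0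
          exact ⟨0, funext fun l => by simp [h0]⟩
      by_cases hi0 : i = 0
      · exact ⟨1, c i, det_one, by rw [vecMul_one, ← hi0, ← hi]⟩
      -- Copy the only nonzero entry to place `0`, then subtract it from place `i`.
      · refine ⟨transvection i 0 1 * transvection 0 i (-1), c i, ?_, ?_⟩
        · rw [det_mul, det_transvection_of_ne _ _ hi0, det_transvection_of_ne _ _ (Ne.symm hi0),
            one_mul]
        rw [← vecMul_vecMul, vecMul_transvection, vecMul_transvection, hi]
        ext l
        by_cases h1 : l = i
        · subst h1; simp [hi0, Ne.symm hi0]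
        · by_cases h2 : l = 0
          · subst h2; simp [Ne.symm hi0]
          · simp [h1, h2]

end Integers

/-! ### Short lattice vectors -/

section Minkowski

/-- **Minkowski's theorem** for the lattice spanned by the rows of a matrix. -/
theorem exists_ne_zero_vecMul_le {n : ℕ} (g : Matrix (Fin n) (Fin n) ℝ) (hn : 0 < n)
    (h0 : 0 < g.det) (h1 : g.det ≤ 1) :
    ∃ c : Fin n → ℤ, c ≠ 0 ∧ ∀ j, |((fun i => (c i : ℝ)) ᵥ* g) j| ≤ 2 := by
  have : NeZero n := ⟨hn.ne'⟩
  let f : (Fin n → ℝ) →ₗ[ℝ] (Fin n → ℝ) := toLin' gᵀ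
  have hf : ∀ x, f x = x ᵥ* g := fun x => by simp [f, toLin'_apply, mulVec_transpose]
  have hdet : LinearMap.det f = g.det := by simp [f]
  -- Radius `2` gives volume at least `4 ^ n`, hence the strict inequality with `2 ^ n` that
  -- Minkowski's theorem needs; radius `1` could give equality.
  let s : Set (Fin n → ℝ) := f ⁻¹' Metric.closedBall 0 2
  have hvol : volume s = ENNReal.ofReal |g.det⁻¹| * ENNReal.ofReal (4 ^ n) := by
    rw [Measure.addHaar_preimage_linearMap _ (by rw [hdet]; exact h0.ne'), hdet,
      Real.volume_pi_closedBall _ zero_le_two]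
    norm_num
  let b := Pi.basisFun ℝ (Fin n)
  have fund := ZSpan.isAddFundamentalDomain' b (volume : Measure (Fin n → ℝ))
  have : Countable (Submodule.span ℤ (Set.range b)).toAddSubgroup :=
    inferInstanceAs (Countable (Submodule.span ℤ (Set.range b)))
  obtain ⟨x, hx, hxs⟩ := exists_ne_zero_mem_lattice_of_measure_mul_two_pow_lt_measure
    (s := s) fund (fun x hx => by simpa [s] using hx)
    ((convex_closedBall (0 : Fin n → ℝ) 2).linear_preimage f) (by
      rw [hvol, ZSpan.volume_fundamentalDomain]
      have e1 : (1 : ℝ) ≤ |g.det⁻¹| := by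
        rw [abs_of_pos (inv_pos.2 h0)]
        exact (one_le_inv₀ h0).2 h1
      have e2 : (2 : ℝ) ^ n < 4 ^ n := pow_lt_pow_left₀ (by norm_num) (by norm_num) hn.ne'
      rw [← ENNReal.ofReal_mul (abs_nonneg _)]
      have e3 : ENNReal.ofReal |(Matrix.of ⇑b).det| * 2 ^ Module.finrank ℝ (Fin n → ℝ)
          = ENNReal.ofReal (2 ^ n) := by
        have : (Matrix.of ⇑b) = 1 := by
          ext i j
          simp [b, Matrix.one_apply, Pi.single_apply, eq_comm]
        rw [this]
        simp [ENNReal.ofReal_pow]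
      rw [e3]
      refine (ENNReal.ofReal_lt_ofReal_iff (by positivity)).2 ?_
      nlinarith [pow_pos (show (0 : ℝ) < 4 by norm_num) n])
  obtain ⟨c, hc⟩ : ∃ c : Fin n → ℤ, (fun i => (c i : ℝ)) = (x : Fin n → ℝ) := by
    have hx' := (Module.Basis.mem_span_iff_repr_mem ℤ b (x : Fin n → ℝ)).1 x.2
    choose c hc using hx'
    exact ⟨c, funext fun i => by simpa [b] using hc i⟩
  refine ⟨c, ?_, fun j => ?_⟩
  · rintro rfl
    exact hx (Subtype.ext (by rw [← hc]; ext; simp))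
  · rw [hc, ← hf]
    have h2 : ‖f x‖ ≤ 2 := by simpa [s] using hxs
    exact (norm_le_pi_norm (f x) j).trans h2

end Minkowski

/-! ### Reduction theory by induction on the dimension -/

section Reduction

/-- Some integral matrix of determinant one moves a real matrix of small determinant to one with
small first row. -/
theorem exists_first_row_le {d : ℕ} (g : Matrix (Fin (d + 1)) (Fin (d + 1)) ℝ)
    (h0 : 0 < g.det) (h1 : g.det ≤ 1) :
    ∃ γ : Matrix (Fin (d + 1)) (Fin (d + 1)) ℤ, γ.det = 1 ∧
      ∀ j, |(γ.map (Int.cast : ℤ → ℝ) * g) 0 j| ≤ 2 := by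
  obtain ⟨c, hc0, hc⟩ := exists_ne_zero_vecMul_le g d.succ_pos h0 h1
  obtain ⟨γ, k, hγ, hk⟩ := exists_vecMul_eq_single c
  -- The adjugate is the inverse of `γ`, so its first row is `c` divided by the nonzero integer `k`,
  -- and its image under `g` is no longer than that of `c`.
  have hck : c = k • γ.adjugate 0 := by
    have h2 : c ᵥ* γ ᵥ* γ.adjugate = c := by
      rw [vecMul_vecMul, mul_adjugate, hγ, one_smul, vecMul_one]
    rw [hk, single_vecMul] at h2
    exact h2.symm
  have hk0 : k ≠ 0 := by
    rintro rfl
    exact hc0 (by simpa using hck)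
  refine ⟨γ.adjugate, by rw [det_adjugate, hγ, one_pow], fun j => ?_⟩
  have h3 : ((fun i => (c i : ℝ)) ᵥ* g) j
      = k * (γ.adjugate.map (Int.cast : ℤ → ℝ) * g) 0 j := by
    rw [hck]
    simp [vecMul, dotProduct, mul_apply, Finset.mul_sum, mul_assoc]
  have h4 := hc j
  rw [h3, abs_mul] at h4
  have h5 : (1 : ℝ) ≤ |(k : ℝ)| := by exact_mod_cast Int.one_le_abs hk0
  exact (le_mul_of_one_le_left (abs_nonneg _) h5).trans h4

/-- The block matrix with given top left corner, first row, first column and remaining block. -/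
def bordered {R : Type*} {d : ℕ} (a : R) (r c : Fin d → R) (D : Matrix (Fin d) (Fin d) R) :
    Matrix (Fin (d + 1)) (Fin (d + 1)) R :=
  Matrix.of (Fin.cons (Fin.cons a r : Fin (d + 1) → R)
    (fun i => (Fin.cons (c i) (D i) : Fin (d + 1) → R)))

section Bordered

variable {R : Type*} {d : ℕ} (a : R) (r c : Fin d → R) (D : Matrix (Fin d) (Fin d) R)

@[simp] theorem bordered_zero_zero : bordered a r c D 0 0 = a := rfl

@[simp] theorem bordered_zero_succ (j : Fin d) : bordered a r c D 0 j.succ = r j := rfl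

@[simp] theorem bordered_succ_zero (i : Fin d) : bordered a r c D i.succ 0 = c i := rfl

@[simp] theorem bordered_succ_succ (i j : Fin d) : bordered a r c D i.succ j.succ = D i j := rfl

end Bordered

theorem det_of_first_row {R : Type*} [CommRing R] {d : ℕ}
    (X : Matrix (Fin (d + 1)) (Fin (d + 1)) R) (hX : ∀ j : Fin d, X 0 j.succ = 0) :
    X.det = X 0 0 * (X.submatrix Fin.succ Fin.succ).det := by
  rw [det_succ_row_zero, Fin.sum_univ_succ]
  simp [hX, Fin.succAbove_zero]

theorem det_of_first_column {R : Type*} [CommRing R] {d : ℕ}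
    (X : Matrix (Fin (d + 1)) (Fin (d + 1)) R) (hX : ∀ i : Fin d, X i.succ 0 = 0) :
    X.det = X 0 0 * (X.submatrix Fin.succ Fin.succ).det := by
  rw [det_succ_column_zero, Fin.sum_univ_succ]
  simp [hX, Fin.succAbove_zero]

/-- A matrix of determinant one which takes the row `v` to the first basis vector. -/
noncomputable def clearing {d : ℕ} (v : Fin (d + 2) → ℝ) : Matrix (Fin (d + 2)) (Fin (d + 2)) ℝ :=
  bordered (v 0)⁻¹ (fun j => -((v 0)⁻¹ * v j.succ * (Fin.cons (v 0) 1 : Fin (d + 1) → ℝ) j)) 0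
    (diagonal (Fin.cons (v 0) 1))

/-- The diagonal entry `v 0` compensates for the corner `(v 0)⁻¹`; size at least two leaves room for
it. -/
theorem det_clearing {d : ℕ} {v : Fin (d + 2) → ℝ} (hv : v 0 ≠ 0) : (clearing v).det = 1 := by
  rw [det_of_first_column _ (fun i => rfl)]
  have : (clearing v).submatrix Fin.succ Fin.succ = diagonal (Fin.cons (v 0) 1) := rfl
  rw [this, det_diagonal, Fin.prod_univ_succ]
  simp [clearing, hv]

theorem vecMul_clearing {d : ℕ} {v : Fin (d + 2) → ℝ} (hv : v 0 ≠ 0) :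
    v ᵥ* clearing v = Pi.single 0 1 := by
  ext j
  refine Fin.cases ?_ (fun j => ?_) j
  · simp [vecMul, dotProduct, Fin.sum_univ_succ _, clearing, hv]
  · rw [vecMul, dotProduct, Fin.sum_univ_succ]
    simp only [clearing, bordered_zero_succ, bordered_succ_succ, diagonal_apply, mul_ite, mul_zero,
      Finset.sum_ite_eq', Finset.mem_univ, if_true]
    rw [Pi.single_eq_of_ne (Fin.succ_ne_zero j)]
    field_simp
    ring

theorem measurable_clearing {d : ℕ} (i j : Fin (d + 2)) :
    Measurable fun v : Fin (d + 2) → ℝ => clearing v i j := by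
  have hs : ∀ j : Fin (d + 1),
      Measurable fun v : Fin (d + 2) → ℝ => (Fin.cons (v 0) 1 : Fin (d + 1) → ℝ) j := by
    intro j
    refine Fin.cases ?_ (fun j => ?_) j
    · simpa using measurable_pi_apply 0
    · simp
  refine Fin.cases ?_ (fun i => ?_) i <;> refine Fin.cases ?_ (fun j => ?_) j
  · exact (measurable_pi_apply 0).inv
  · have h : Measurable fun v : Fin (d + 2) → ℝ =>
        -((v 0)⁻¹ * v j.succ * (Fin.cons (v 0) 1 : Fin (d + 1) → ℝ) j) :=
      (((measurable_pi_apply 0).inv.mul (measurable_pi_apply j.succ)).mul (hs j)).neg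
    exact h
  · exact measurable_const
  · by_cases h : i = j
    · subst h
      simpa [clearing] using hs i
    · simp [clearing, h]

/-- Lebesgue measure on matrices, split along the first row. -/
theorem measurePreserving_first_row (m n : ℕ) :
    MeasurePreserving (fun X : Matrix (Fin (m + 1)) (Fin n) ℝ =>
      ((X 0, X.submatrix Fin.succ id) : (Fin n → ℝ) × Matrix (Fin m) (Fin n) ℝ)) :=
  volume_preserving_piFinSuccAbove (fun _ : Fin (m + 1) => Fin n → ℝ) 0

/-- Lebesgue measure on matrices, split along the first column. -/
theorem measurePreserving_first_column (m n : ℕ) :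
    MeasurePreserving (fun X : Matrix (Fin m) (Fin (n + 1)) ℝ =>
      ((fun i => X i 0, X.submatrix id Fin.succ) : (Fin m → ℝ) × Matrix (Fin m) (Fin n) ℝ)) :=
  (volume_measurePreserving_arrowProdEquivProdArrow ℝ (Fin n → ℝ) (Fin m)).comp
    (volume_preserving_pi (fun _ : Fin m =>
      volume_preserving_piFinSuccAbove (fun _ : Fin (n + 1) => ℝ) 0))

theorem ae_apply_ne_zero {n : ℕ} (i : Fin n) : ∀ᵐ v : Fin n → ℝ, v i ≠ 0 :=
  Measure.ae_eval_ne _ i 0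

theorem ae_matrix_apply_ne_zero {m n : ℕ} (i : Fin m) (j : Fin n) :
    ∀ᵐ X : Matrix (Fin m) (Fin n) ℝ, X i j ≠ 0 :=
  (Measure.tendsto_eval_ae_ae (μ := fun _ : Fin m => (volume : Measure (Fin n → ℝ)))
    (i := i)).eventually (ae_apply_ne_zero j)

/-- The map which clears the first row of a matrix preserves Lebesgue measure. -/
theorem measurePreserving_clear (d m : ℕ) :
    MeasurePreserving (fun p : (Fin (d + 2) → ℝ) × Matrix (Fin m) (Fin (d + 2)) ℝ =>
      (p.1, p.2 * clearing p.1)) := by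
  refine (MeasurePreserving.id (volume : Measure (Fin (d + 2) → ℝ))).skew_product
    (g := fun v (X : Matrix (Fin m) (Fin (d + 2)) ℝ) => X * clearing v) ?_ ?_
  · refine measurable_pi_lambda _ fun i => measurable_pi_lambda _ fun j => ?_
    simp only [Function.uncurry, mul_apply]
    refine Finset.measurable_sum _ fun l _ => ?_
    have h1 : Measurable fun X : Matrix (Fin m) (Fin (d + 2)) ℝ => X i l :=
      (measurable_pi_apply l).comp (measurable_pi_apply (X := fun _ : Fin m => Fin (d + 2) → ℝ) i)
    exact (h1.comp measurable_snd).mul ((measurable_clearing l j).comp measurable_fst)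
  · filter_upwards [ae_apply_ne_zero 0] with v hv
    exact (measurePreserving_mul_right (det_clearing hv)).map_eq

/-- A set of matrices which meets every orbit of `SL_d(ℤ)` on matrices of determinant in
`(0, 1]`. -/
def IsCovering {d : ℕ} (S : Set (Matrix (Fin d) (Fin d) ℝ)) : Prop :=
  ∀ g : Matrix (Fin d) (Fin d) ℝ, 0 < g.det → g.det ≤ 1 →
    ∃ γ : Matrix (Fin d) (Fin d) ℤ, γ.det = 1 ∧ γ.map (Int.cast : ℤ → ℝ) * g ∈ S

/-- The only possible entry is the determinant itself, so the unit ball already contains every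
matrix concerned. -/
theorem exists_isCovering_of_le_one {d : ℕ} (hd : d ≤ 1) :
    ∃ S : Set (Matrix (Fin d) (Fin d) ℝ), MeasurableSet S ∧ volume S < ∞ ∧ IsCovering S := by
  refine ⟨Metric.closedBall (α := Fin d → Fin d → ℝ) 0 1,
    measurableSet_closedBall (α := Fin d → Fin d → ℝ),
    measure_closedBall_lt_top (μ := (volume : Measure (Fin d → Fin d → ℝ))),
    fun g h0 h1 => ⟨1, det_one, ?_⟩⟩
  have hg : (1 : Matrix (Fin d) (Fin d) ℤ).map (Int.cast : ℤ → ℝ) * g = g := by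
    rw [Matrix.map_one _ Int.cast_zero Int.cast_one, one_mul]
  rw [hg]
  refine mem_closedBall_zero_iff (E := Fin d → Fin d → ℝ).2 ?_
  refine (pi_norm_le_iff_of_nonneg zero_le_one).2 fun i =>
    (pi_norm_le_iff_of_nonneg zero_le_one).2 fun j => ?_
  obtain rfl : d = 1 := by have := i.pos; omega
  rw [det_fin_one] at h0 h1
  rw [Subsingleton.elim i 0, Subsingleton.elim j 0, Real.norm_eq_abs, abs_of_pos h0]
  exact h1

/-- The induction step: bounded first row, first column in `[0, 1]` after clearing, and the block in
the smaller covering set. -/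
theorem exists_isCovering_succ {d : ℕ}
    (ih : ∃ S : Set (Matrix (Fin (d + 1)) (Fin (d + 1)) ℝ),
      MeasurableSet S ∧ volume S < ∞ ∧ IsCovering S) :
    ∃ S : Set (Matrix (Fin (d + 2)) (Fin (d + 2)) ℝ),
      MeasurableSet S ∧ volume S < ∞ ∧ IsCovering S := by
  obtain ⟨S, hS, hSfin, hcov⟩ := ih
  let T : Set (Matrix (Fin (d + 1)) (Fin (d + 2)) ℝ) :=
    (fun X => (fun i => X i 0, X.submatrix id Fin.succ)) ⁻¹'
      ((Set.univ.pi fun _ => Set.Icc (0 : ℝ) 1) ×ˢ S)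
  have hbox : MeasurableSet (Set.univ.pi fun _ : Fin (d + 1) => Set.Icc (0 : ℝ) 1) :=
    MeasurableSet.univ_pi fun _ => measurableSet_Icc
  have hT : MeasurableSet T := (measurePreserving_first_column _ _).measurable (hbox.prod hS)
  have hTfin : volume T < ∞ := by
    rw [(measurePreserving_first_column _ _).measure_preimage (hbox.prod hS).nullMeasurableSet,
      Measure.volume_eq_prod, Measure.prod_prod, volume_pi_pi]
    simpa using hSfin
  let B : Set (Fin (d + 2) → ℝ) := Metric.closedBall 0 2
  have hB : MeasurableSet B := measurableSet_closedBall
  have hΦ := (measurePreserving_clear d (d + 1)).comp (measurePreserving_first_row (d + 1) (d + 2))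
  let W : Set (Matrix (Fin (d + 2)) (Fin (d + 2)) ℝ) :=
    ((fun p : (Fin (d + 2) → ℝ) × Matrix (Fin (d + 1)) (Fin (d + 2)) ℝ =>
      (p.1, p.2 * clearing p.1)) ∘ fun X => (X 0, X.submatrix Fin.succ id)) ⁻¹' (B ×ˢ T)
  have hW : MeasurableSet W := hΦ.measurable (hB.prod hT)
  have hWfin : volume W < ∞ := by
    rw [hΦ.measure_preimage (hB.prod hT).nullMeasurableSet, Measure.volume_eq_prod,
      Measure.prod_prod]
    exact ENNReal.mul_lt_top measure_closedBall_lt_top hTfin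
  -- Clearing fails when the corner entry vanishes. This happens for some integral translate only on
  -- a countable union of null sets, which is added to the covering set whole.
  let N : Set (Matrix (Fin (d + 2)) (Fin (d + 2)) ℝ) :=
    {g | ¬ ∀ γ : {γ : Matrix (Fin (d + 2)) (Fin (d + 2)) ℤ // γ.det = 1},
      (γ.1.map (Int.cast : ℤ → ℝ) * g) 0 0 ≠ 0}
  have hN : volume N = 0 := by
    have : Countable (Matrix (Fin (d + 2)) (Fin (d + 2)) ℤ) :=
      inferInstanceAs (Countable (Fin (d + 2) → Fin (d + 2) → ℤ))
    refine ae_iff.1 (ae_all_iff.2 fun γ => ?_)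
    have hdet : (γ.1.map (Int.cast : ℤ → ℝ)).det = 1 := by
      have := Int.cast_det (R := ℝ) γ.1
      rw [γ.2, Int.cast_one] at this
      exact this.symm
    exact (measurePreserving_mul_left hdet).quasiMeasurePreserving.ae
      (ae_matrix_apply_ne_zero 0 0)
  refine ⟨W ∪ toMeasurable volume N, hW.union (measurableSet_toMeasurable _ _), ?_,
    fun g h0 h1 => ?_⟩
  · refine (measure_union_le _ _).trans_lt ?_
    rw [measure_toMeasurable, hN, add_zero]
    exact hWfin
  by_cases hgN : g ∈ N
  · refine ⟨1, det_one, Or.inr (subset_toMeasurable _ _ ?_)⟩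
    rwa [Matrix.map_one _ Int.cast_zero Int.cast_one, one_mul]
  obtain ⟨γ₁, hγ₁, hrow⟩ := exists_first_row_le g h0 h1
  have hdet₁ : (γ₁.map (Int.cast : ℤ → ℝ)).det = 1 := by
    have := Int.cast_det (R := ℝ) γ₁
    rw [hγ₁, Int.cast_one] at this
    exact this.symm
  set g₁ := γ₁.map (Int.cast : ℤ → ℝ) * g with hg₁
  have hv : g₁ 0 0 ≠ 0 := not_not.1 hgN ⟨γ₁, hγ₁⟩
  set Y := g₁ * clearing (g₁ 0) with hY
  have hY0 : Y 0 = Pi.single 0 1 := vecMul_clearing hv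
  have hYdet : Y.det = g.det := by
    rw [hY, det_mul, det_clearing hv, hg₁, det_mul, hdet₁, one_mul, mul_one]
  have hD : (Y.submatrix Fin.succ Fin.succ).det = g.det := by
    rw [← hYdet, det_of_first_row Y fun j => by simp [hY0], hY0]
    simp
  obtain ⟨δ, hδ, hδS⟩ := hcov (Y.submatrix Fin.succ Fin.succ) (hD ▸ h0) (hD ▸ h1)
  -- The first column below the corner after `δ` acts. The first row of `Y` is the basis vector, so
  -- subtracting `⌊c i⌋` times it leaves the fractional part and does not touch the block.
  let c : Fin (d + 1) → ℝ := fun i => ∑ l, (δ i l : ℝ) * Y l.succ 0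
  let γ₂ : Matrix (Fin (d + 2)) (Fin (d + 2)) ℤ := bordered 1 0 (fun i => -⌊c i⌋) δ
  have hγ₂ : γ₂.det = 1 := by
    rw [det_of_first_row _ fun j => rfl]
    have : γ₂.submatrix Fin.succ Fin.succ = δ := rfl
    rw [this, hδ]
    rfl
  have hrow₂ : (γ₂.map (Int.cast : ℤ → ℝ) * g₁) 0 = g₁ 0 := by
    ext j
    simp [mul_apply, Fin.sum_univ_succ _, γ₂]
  refine ⟨γ₂ * γ₁, by rw [det_mul, hγ₁, hγ₂, one_mul], Or.inl ?_⟩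
  have hmap : (γ₂ * γ₁).map (Int.cast : ℤ → ℝ) * g = γ₂.map (Int.cast : ℤ → ℝ) * g₁ := by
    rw [hg₁, ← Matrix.mul_assoc]
    congr 1
    exact Matrix.map_mul (f := Int.castRingHom ℝ)
  rw [hmap]
  refine ⟨?_, ?_⟩
  · change (γ₂.map (Int.cast : ℤ → ℝ) * g₁) 0 ∈ B
    rw [hrow₂, mem_closedBall_zero_iff]
    exact (pi_norm_le_iff_of_nonneg zero_le_two).2 hrow
  · change (γ₂.map (Int.cast : ℤ → ℝ) * g₁).submatrix Fin.succ id *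
      clearing ((γ₂.map (Int.cast : ℤ → ℝ) * g₁) 0) ∈ T
    rw [hrow₂]
    -- Since `γ₂` fixes the first row, the clearing matrix is unchanged, and associativity lets `γ₂`
    -- act after clearing.
    have hmul : (γ₂.map (Int.cast : ℤ → ℝ) * g₁).submatrix Fin.succ id * clearing (g₁ 0)
        = (γ₂.map (Int.cast : ℤ → ℝ) * Y).submatrix Fin.succ id := by
      rw [hY, ← Matrix.mul_assoc _ g₁]
      rfl
    rw [hmul]
    refine ⟨fun i _ => ?_, ?_⟩
    · have h3 : (γ₂.map (Int.cast : ℤ → ℝ) * Y) i.succ 0 = Int.fract (c i) := by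
        rw [mul_apply, Fin.sum_univ_succ, hY0, ← Int.self_sub_floor]
        simp [γ₂, c, sub_eq_neg_add]
      change (γ₂.map (Int.cast : ℤ → ℝ) * Y) i.succ 0 ∈ Set.Icc (0 : ℝ) 1
      rw [h3]
      exact ⟨Int.fract_nonneg _, (Int.fract_lt_one _).le⟩
    · have h4 : ((γ₂.map (Int.cast : ℤ → ℝ) * Y).submatrix Fin.succ id).submatrix id Fin.succ
          = δ.map (Int.cast : ℤ → ℝ) * Y.submatrix Fin.succ Fin.succ := by
        ext i j
        simp only [submatrix_apply, id_eq]
        rw [mul_apply, Fin.sum_univ_succ, hY0]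
        simp [γ₂, mul_apply]
      change ((γ₂.map (Int.cast : ℤ → ℝ) * Y).submatrix Fin.succ id).submatrix id Fin.succ ∈ S
      rw [h4]
      exact hδS

/-- **Reduction theory**: the matrices of determinant in `(0, 1]` are covered by the translates
under `SL_d(ℤ)` of a set of finite Lebesgue measure. -/
theorem exists_isCovering (d : ℕ) :
    ∃ S : Set (Matrix (Fin d) (Fin d) ℝ), MeasurableSet S ∧ volume S < ∞ ∧ IsCovering S := by
  match d with
  | 0 => exact exists_isCovering_of_le_one zero_le_one
  | 1 => exact exists_isCovering_of_le_one le_rfl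
  | d + 2 => exact exists_isCovering_succ (exists_isCovering (d + 1))

end Reduction

/-! ### Borel fundamental sets of discrete subgroups -/

section FundamentalSet

variable {G : Type*} [Group G] [TopologicalSpace G] [IsTopologicalGroup G]

/-- By continuity of division. Each translate `W * x` then meets every coset `Γ y` at most once. -/
theorem exists_isOpen_of_discreteTopology (Γ : Subgroup G) [DiscreteTopology Γ] :
    ∃ W : Set G, IsOpen W ∧ 1 ∈ W ∧ ∀ v ∈ W, ∀ w ∈ W, v / w ∈ Γ → v / w = 1 := by
  obtain ⟨U, hU, hUΓ⟩ := isOpen_induced_iff.1 (isOpen_discrete ({1} : Set Γ))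
  have h1 : (1 : Γ) ∈ Subtype.val ⁻¹' U := by rw [hUΓ]; rfl
  obtain ⟨V, hV, hVU⟩ := exists_nhds_split_inv (hU.mem_nhds h1)
  refine ⟨interior V, isOpen_interior, mem_interior_iff_mem_nhds.2 hV, fun v hv w hw hvw => ?_⟩
  have h2 : (⟨v / w, hvw⟩ : Γ) ∈ Subtype.val ⁻¹' U :=
    hVU v (interior_subset hv) w (interior_subset hw)
  rw [hUΓ] at h2
  exact congrArg Subtype.val h2

/-- A discrete subgroup of a second countable group has a Borel fundamental set. -/
theorem exists_isFundamentalSet [SecondCountableTopology G] [MeasurableSpace G] [BorelSpace G]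
    (Γ : Subgroup G) [DiscreteTopology Γ] :
    ∃ F : Set G, MeasurableSet F ∧ IsFundamentalSet Γ F := by
  classical
  obtain ⟨W, hWo, hW1, hW⟩ := exists_isOpen_of_discreteTopology Γ
  obtain ⟨s, hs, hcov⟩ := TopologicalSpace.countable_cover_nhds (α := G)
    (f := fun x => (fun y => y * x⁻¹) ⁻¹' W)
    (fun x => (hWo.preimage (continuous_mul_const x⁻¹)).mem_nhds (by simpa using hW1))
  have hsne : s.Nonempty := by
    by_contra h
    rw [Set.not_nonempty_iff_eq_empty] at h
    subst h
    simpa using (Set.ext_iff.1 hcov 1).2 trivial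
  obtain ⟨x, rfl⟩ := hs.exists_eq_range hsne
  let V : ℕ → Set G := fun n => (fun y => y * (x n)⁻¹) ⁻¹' W
  have hVo : ∀ n, IsOpen (V n) := fun n => hWo.preimage (continuous_mul_const _)
  let P : ℕ → Set G := fun n => ⋃ γ : Γ, (fun y => (γ : G) * y) ⁻¹' V n
  have hPo : ∀ n, IsOpen (P n) := fun n =>
    isOpen_iUnion fun γ => (hVo n).preimage (continuous_const_mul _)
  have hPmem : ∀ n y, y ∈ P n ↔ ∃ γ ∈ Γ, γ * y ∈ V n := fun n y => by simp [P]
  have hPinv : ∀ n, ∀ γ ∈ Γ, ∀ y, γ * y ∈ P n ↔ y ∈ P n := by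
    intro n γ hγ y
    rw [hPmem, hPmem]
    constructor
    · rintro ⟨δ, hδ, h⟩
      exact ⟨δ * γ, Γ.mul_mem hδ hγ, by rwa [mul_assoc]⟩
    · rintro ⟨δ, hδ, h⟩
      exact ⟨δ * γ⁻¹, Γ.mul_mem hδ (Γ.inv_mem hγ), by simpa [mul_assoc] using h⟩
  have hVP : ∀ n y, y ∈ V n → y ∈ P n := fun n y h =>
    (hPmem n y).2 ⟨1, Γ.one_mem, by rwa [one_mul]⟩
  -- From each `V n` discard the cosets already met by an earlier one (`P k` is the saturation of `V
  -- k`), so every coset is represented only at its least index.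
  let F : Set G := ⋃ n, V n \ ⋃ k, ⋃ _ : k < n, P k
  have hFmem : ∀ y, y ∈ F ↔ ∃ n, y ∈ V n ∧ ∀ k < n, y ∉ P k := fun y => by simp [F]
  refine ⟨F, MeasurableSet.iUnion fun n => (hVo n).measurableSet.diff <|
    MeasurableSet.iUnion fun k => MeasurableSet.iUnion fun _ => (hPo k).measurableSet, ?_, ?_⟩
  · refine Set.eq_univ_of_forall fun y => ?_
    have hy : ∃ n, y ∈ P n := by
      have h := (Set.ext_iff.1 hcov y).2 trivial
      simp only [Set.mem_iUnion, Set.mem_range, exists_prop, exists_exists_eq_and] at h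
      obtain ⟨n, hn⟩ := h
      exact ⟨n, hVP n y hn⟩
    obtain ⟨γ, hγ, h⟩ := (hPmem _ y).1 (Nat.find_spec hy)
    refine Set.mem_iUnion.2 ⟨⟨γ⁻¹, Γ.inv_mem hγ⟩, Set.mem_smul_set_iff_inv_smul_mem.2 ?_⟩
    refine (hFmem _).2 ⟨Nat.find hy, by simpa using h, fun k hk hkP => Nat.find_min hy hk ?_⟩
    exact (hPinv k γ hγ y).1 (by simpa using hkP)
  · intro γ₁ γ₂ hne
    refine Set.disjoint_left.2 fun y h₁ h₂ => hne ?_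
    rw [Set.mem_smul_set_iff_inv_smul_mem, hFmem] at h₁ h₂
    obtain ⟨n, hn, hn'⟩ := h₁
    obtain ⟨m, hm, hm'⟩ := h₂
    simp only [smul_eq_mul] at hn hn' hm hm'
    have key : ∀ k, ∀ γ : Γ, (γ : G)⁻¹ * y ∈ P k ↔ y ∈ P k := fun k γ =>
      hPinv k _ (Γ.inv_mem γ.2) y
    have hnm : n = m := by
      refine le_antisymm (not_lt.1 fun h => ?_) (not_lt.1 fun h => ?_)
      · exact hn' m h ((key m γ₁).2 ((key m γ₂).1 (hVP _ _ hm)))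
      · exact hm' n h ((key n γ₂).2 ((key n γ₁).1 (hVP _ _ hn)))
    subst hnm
    have hdiv : ((γ₁ : G)⁻¹ * y * (x n)⁻¹) / ((γ₂ : G)⁻¹ * y * (x n)⁻¹) = (γ₁ : G)⁻¹ * γ₂ := by
      simp [div_eq_mul_inv, mul_assoc]
    have h := hW _ hn _ hm (by
      rw [hdiv]
      exact Γ.mul_mem (Γ.inv_mem γ₁.2) γ₂.2)
    rw [hdiv, inv_mul_eq_one] at h
    exact Subtype.ext h

end FundamentalSet

/-! ### Haar measure from the truncated cone -/

section Cone

variable {d : ℕ}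

instance instSecondCountableTopologySL (d : ℕ) :
    SecondCountableTopology (SpecialLinearGroup (Fin d) ℝ) :=
  have : SecondCountableTopology (Matrix (Fin d) (Fin d) ℝ) :=
    inferInstanceAs (SecondCountableTopology (Fin d → Fin d → ℝ))
  (isClosedEmbedding_coe d).isEmbedding.secondCountableTopology

/-- The factor which scales a matrix of positive determinant to a matrix of determinant one. -/
noncomputable def detScale (A : Matrix (Fin d) (Fin d) ℝ) : ℝ := A.det ^ (-(d : ℝ)⁻¹)

theorem det_detScale_smul {A : Matrix (Fin d) (Fin d) ℝ} (hA : 0 < A.det) :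
    (detScale A • A).det = 1 := by
  rw [det_smul, Fintype.card_fin, detScale]
  rcases Nat.eq_zero_or_pos d with rfl | hd
  · simp
  · have hd' : (d : ℝ) ≠ 0 := by exact_mod_cast hd.ne'
    rw [← Real.rpow_natCast, ← Real.rpow_mul hA.le, neg_mul, inv_mul_cancel₀ hd', Real.rpow_neg_one,
      inv_mul_cancel₀ hA.ne']

open Classical in
/-- The radial projection of matrices of positive determinant to the special linear group. -/
noncomputable def radialProj (A : Matrix (Fin d) (Fin d) ℝ) : SpecialLinearGroup (Fin d) ℝ :=
  if h : 0 < A.det then ⟨detScale A • A, det_detScale_smul h⟩ else 1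

theorem coe_radialProj {A : Matrix (Fin d) (Fin d) ℝ} (hA : 0 < A.det) :
    (radialProj A : Matrix (Fin d) (Fin d) ℝ) = detScale A • A := by
  have h : radialProj A = ⟨detScale A • A, det_detScale_smul hA⟩ := dif_pos hA
  rw [h]

theorem radialProj_mul (g : SpecialLinearGroup (Fin d) ℝ) {A : Matrix (Fin d) (Fin d) ℝ}
    (hA : 0 < A.det) :
    radialProj ((g : Matrix (Fin d) (Fin d) ℝ) * A) = g * radialProj A := by
  have hdet : ((g : Matrix (Fin d) (Fin d) ℝ) * A).det = A.det := by
    rw [det_mul, g.det_coe, one_mul]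
  refine Subtype.ext ?_
  rw [Matrix.SpecialLinearGroup.coe_mul, coe_radialProj hA, coe_radialProj (hdet ▸ hA), detScale, hdet,
    detScale, Matrix.mul_smul]

theorem measurable_det : Measurable fun A : Matrix (Fin d) (Fin d) ℝ => A.det :=
  (continuous_id.matrix_det).measurable

theorem measurable_radialProj :
    Measurable (radialProj : Matrix (Fin d) (Fin d) ℝ → SpecialLinearGroup (Fin d) ℝ) := by
  rw [← (isClosedEmbedding_coe d).measurableEmbedding.measurable_comp_iff]
  have : (fun g : SpecialLinearGroup (Fin d) ℝ => (g : Matrix (Fin d) (Fin d) ℝ)) ∘ radialProj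
      = fun A => if 0 < A.det then detScale A • A else 1 := by
    ext1 A
    by_cases h : 0 < A.det
    · simp [h, coe_radialProj]
    · simp [h, radialProj]
  rw [this]
  refine Measurable.ite (measurableSet_lt measurable_const measurable_det) ?_ measurable_const
  refine measurable_pi_lambda _ fun i => measurable_pi_lambda _ fun j => ?_
  have h : Measurable fun A : Matrix (Fin d) (Fin d) ℝ => A i j :=
    (measurable_pi_apply j).comp (measurable_pi_apply (X := fun _ : Fin d => Fin d → ℝ) i)
  exact (measurable_det.pow_const _).mul h

/-- The truncated cone over the special linear group. -/
def unitCone (d : ℕ) : Set (Matrix (Fin d) (Fin d) ℝ) := {A | 0 < A.det ∧ A.det ≤ 1}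

theorem measurableSet_unitCone : MeasurableSet (unitCone d) :=
  (measurableSet_lt measurable_const measurable_det).inter
    (measurableSet_le measurable_det measurable_const)

theorem mul_mem_unitCone (g : SpecialLinearGroup (Fin d) ℝ) (A : Matrix (Fin d) (Fin d) ℝ) :
    (g : Matrix (Fin d) (Fin d) ℝ) * A ∈ unitCone d ↔ A ∈ unitCone d := by
  simp only [unitCone, Set.mem_ofPred_eq, det_mul, g.det_coe, one_mul]

/-- The measure on the special linear group which sends a set to the Lebesgue measure of the
truncated cone over it. -/
noncomputable def coneMeasure (d : ℕ) : Measure (SpecialLinearGroup (Fin d) ℝ) :=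
  (volume.restrict (unitCone d)).map radialProj

theorem coneMeasure_apply {B : Set (SpecialLinearGroup (Fin d) ℝ)} (hB : MeasurableSet B) :
    coneMeasure d B = volume (radialProj ⁻¹' B ∩ unitCone d) := by
  rw [coneMeasure, Measure.map_apply measurable_radialProj hB,
    Measure.restrict_apply (measurable_radialProj hB)]

/-- Radial projection commutes with left multiplication by `g`, which preserves both the truncated
cone and Lebesgue measure. -/
instance instIsMulLeftInvariantConeMeasure : (coneMeasure d).IsMulLeftInvariant := by
  refine ⟨fun g => ?_⟩
  have hg := measurePreserving_mul_left g.det_coe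
  ext B hB
  have hgB : MeasurableSet ((fun x => g * x) ⁻¹' B) := (measurable_const_mul g) hB
  rw [Measure.map_apply (measurable_const_mul g) hB, coneMeasure_apply hB, coneMeasure_apply hgB,
    ← hg.measure_preimage
      ((measurable_radialProj hB).inter measurableSet_unitCone).nullMeasurableSet]
  congr 1
  ext A
  simp only [Set.mem_inter_iff, Set.mem_preimage, mul_mem_unitCone]
  refine and_congr_left fun hA => ?_
  rw [radialProj_mul g hA.1]

instance instIsFiniteMeasureOnCompactsConeMeasure :
    IsFiniteMeasureOnCompacts (coneMeasure d) := by
  refine ⟨fun K hK => ?_⟩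
  have hcont : Continuous fun g : SpecialLinearGroup (Fin d) ℝ =>
      (fun i j => g i j : Fin d → Fin d → ℝ) := (isClosedEmbedding_coe d).continuous
  obtain ⟨C, hC⟩ := (hK.image hcont).isBounded.exists_norm_le
  let B : Set (SpecialLinearGroup (Fin d) ℝ) :=
    (fun g => (fun i j => g i j : Fin d → Fin d → ℝ)) ⁻¹' Metric.closedBall 0 C
  have hKB : K ⊆ B := fun g hg => mem_closedBall_zero_iff.2 (hC _ ⟨g, hg, rfl⟩)
  have hB : MeasurableSet B := (Metric.isClosed_closedBall.preimage hcont).measurableSet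
  refine (measure_mono hKB).trans_lt ?_
  rw [coneMeasure_apply hB]
  refine (measure_mono fun A hA => ?_).trans_lt
    (measure_closedBall_lt_top (μ := (volume : Measure (Fin d → Fin d → ℝ))) (x := 0) (r := C))
  obtain ⟨hAB, hA0, hA1⟩ := hA
  -- Determinant at most `1` means that projecting only enlarges entries, so the truncated cone over
  -- a bounded set obeys the same bound.
  have hs : 1 ≤ detScale A :=
    Real.one_le_rpow_of_pos_of_le_one_of_nonpos hA0 hA1 (neg_nonpos.2 (by positivity))
  have hnorm := mem_closedBall_zero_iff.1 hAB
  have hC0 : 0 ≤ C := (norm_nonneg _).trans hnorm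
  refine mem_closedBall_zero_iff (E := Fin d → Fin d → ℝ).2 ?_
  refine (pi_norm_le_iff_of_nonneg hC0).2 fun i => (pi_norm_le_iff_of_nonneg hC0).2 fun j => ?_
  have hij := (pi_norm_le_iff_of_nonneg hC0).1 ((pi_norm_le_iff_of_nonneg hC0).1 hnorm i) j
  have hcoe : radialProj A i j = detScale A * A i j :=
    congrFun (congrFun (coe_radialProj hA0) i) j
  simp only [hcoe, norm_mul, Real.norm_eq_abs, abs_of_pos (one_pos.trans_le hs)] at hij
  exact (le_mul_of_one_le_left (abs_nonneg _) hs).trans hij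

theorem coneMeasure_ne_zero (hd : d ≠ 0) : coneMeasure d ≠ 0 := by
  intro h
  have h1 : volume (unitCone d) = 0 := by
    have := coneMeasure_apply (d := d) MeasurableSet.univ
    rw [h] at this
    simpa using this.symm
  -- An open part of the cone, containing half the identity; it is empty for `d = 0`, where every
  -- determinant is `1`.
  let U : Set (Fin d → Fin d → ℝ) := {A | 0 < (Matrix.of A).det ∧ (Matrix.of A).det < 1}
  have hc : Continuous fun A : Fin d → Fin d → ℝ => (Matrix.of A).det :=
    Continuous.matrix_det (continuous_id (X := Matrix (Fin d) (Fin d) ℝ))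
  have hU : IsOpen U := (isOpen_lt continuous_const hc).inter (isOpen_lt hc continuous_const)
  have hUne : U.Nonempty := by
    refine ⟨((1 / 2 : ℝ) • (1 : Matrix (Fin d) (Fin d) ℝ)), ?_⟩
    have : ((1 / 2 : ℝ) • (1 : Matrix (Fin d) (Fin d) ℝ)).det = (1 / 2) ^ d := by simp
    refine ⟨?_, ?_⟩
    · exact this ▸ (by positivity : (0 : ℝ) < (1 / 2) ^ d)
    · exact this ▸ pow_lt_one₀ (by norm_num) (by norm_num) hd
  refine (hU.measure_pos volume hUne).ne' (measure_mono_null (fun A hA => ?_) h1)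
  exact ⟨hA.1, hA.2.le⟩

end Cone

/-! ### Finite covolume -/

section Lattice

variable {d : ℕ}

theorem coneMeasure_lt_top {F : Set (SpecialLinearGroup (Fin d) ℝ)} (hF : MeasurableSet F)
    (hfund : IsFundamentalSet (integerSL d) F) : coneMeasure d F < ∞ := by
  obtain ⟨S, hS, hSfin, hcov⟩ := exists_isCovering d
  have : Countable (Matrix (Fin d) (Fin d) ℤ) := inferInstanceAs (Countable (Fin d → Fin d → ℤ))
  have : Countable (SpecialLinearGroup (Fin d) ℤ) := Subtype.countable
  have : Countable (integerSL d) := (Set.countable_range _).to_subtype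
  let E := radialProj ⁻¹' F ∩ unitCone d
  have hE : MeasurableSet E := (measurable_radialProj hF).inter measurableSet_unitCone
  let L : SpecialLinearGroup (Fin d) ℝ → Matrix (Fin d) (Fin d) ℝ → Matrix (Fin d) (Fin d) ℝ :=
    fun g A => (g : Matrix (Fin d) (Fin d) ℝ) * A
  have hL : ∀ g, MeasurePreserving (L g) := fun g => measurePreserving_mul_left g.det_coe
  have hLinv : ∀ g A, L g⁻¹ (L g A) = A := fun g A => by
    simp only [L]
    rw [← Matrix.mul_assoc, ← Matrix.SpecialLinearGroup.coe_mul, inv_mul_cancel,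
      Matrix.SpecialLinearGroup.coe_one, one_mul]
  -- `Q γ` is `γE ∩ S`. Moved back by `γ⁻¹` these sets cover `E`, while in place they are disjoint
  -- inside `S`.
  let Q : integerSL d → Set (Matrix (Fin d) (Fin d) ℝ) := fun γ => L (γ : _)⁻¹ ⁻¹' E ∩ S
  have hQ : ∀ γ, MeasurableSet (Q γ) := fun γ => ((hL _).measurable hE).inter hS
  have hsub : E ⊆ ⋃ γ : integerSL d, L γ ⁻¹' Q γ := by
    intro A hA
    obtain ⟨γ, hγ, hγS⟩ := hcov A hA.2.1 hA.2.2
    refine Set.mem_iUnion.2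
      ⟨⟨SpecialLinearGroup.map (Int.castRingHom ℝ) ⟨γ, hγ⟩, ⟨γ, hγ⟩, rfl⟩, ?_, hγS⟩
    rw [Set.mem_preimage, hLinv]
    exact hA
  have hdisj : Pairwise (Function.onFun Disjoint Q) := by
    intro γ δ hne
    refine Set.disjoint_left.2 fun A hA hA' => ?_
    have hdet : A ∈ unitCone d := (mul_mem_unitCone _ A).1 hA.1.2
    have h : ∀ η : integerSL d, A ∈ Q η → radialProj A ∈ (η : SpecialLinearGroup (Fin d) ℝ) • F := by
      intro η hη
      rw [Set.mem_smul_set_iff_inv_smul_mem, smul_eq_mul, ← radialProj_mul _ hdet.1]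
      exact hη.1.1
    exact Set.disjoint_left.1 (hfund.disjoint γ δ hne) (h γ hA) (h δ hA')
  rw [coneMeasure_apply hF]
  calc volume E ≤ ∑' γ : integerSL d, volume (L γ ⁻¹' Q γ) :=
        (measure_mono hsub).trans (measure_iUnion_le _)
    _ = ∑' γ : integerSL d, volume (Q γ) :=
        tsum_congr fun γ => (hL γ).measure_preimage (hQ γ).nullMeasurableSet
    _ = volume (⋃ γ, Q γ) := (measure_iUnion hdisj hQ).symm
    _ ≤ volume S := measure_mono (Set.iUnion_subset fun γ => Set.inter_subset_right)
    _ < ∞ := hSfin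

theorem haarMeasure_lt_top (m : Measure (SpecialLinearGroup (Fin d) ℝ)) [m.IsHaarMeasure]
    {F : Set (SpecialLinearGroup (Fin d) ℝ)} (hF : MeasurableSet F)
    (hfund : IsFundamentalSet (integerSL d) F) : m F < ∞ := by
  rcases eq_or_ne d 0 with rfl | hd
  -- For `d = 0` the group is trivial.
  · exact (Set.toFinite F).isCompact.measure_lt_top
  · have h := Measure.isMulLeftInvariant_eq_smul (coneMeasure d) m
    have hfin := coneMeasure_lt_top hF hfund
    have hc : Measure.haarScalarFactor (coneMeasure d) m ≠ 0 := fun hc =>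
      coneMeasure_ne_zero hd (by rw [h, hc, zero_smul])
    rw [h] at hfin
    refine ENNReal.lt_top_of_mul_ne_top_right (a := Measure.haarScalarFactor (coneMeasure d) m)
      ?_ (by exact_mod_cast hc)
    exact hfin.ne

end Lattice

end HomogeneousLattice

theorem mainTheorem2 (d : ℕ) :
    HomogeneousLattice.IsLattice (HomogeneousLattice.integerSL d) := by
  have hdisc : DiscreteTopology (HomogeneousLattice.integerSL d) := by
    unfold HomogeneousLattice.integerSL
    infer_instance
  refine ⟨hdisc, HomogeneousLattice.exists_isFundamentalSet _, fun m _ F hF hfund => ?_⟩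
  rw [HomogeneousLattice.quotientMeasure_apply _ _ _ MeasurableSet.univ, Set.preimage_univ,
    Set.univ_inter]
  exact HomogeneousLattice.haarMeasure_lt_top m hF hfund
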